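/- Let $n\ge 1$ and $A,B\in\mathbb{C}^{n\times n}$. Let $\lambda_1(A),\dots,\lambda_n(A)$ and $\lambda_1(B),\dots,\lambda_n(B)$ be the eigenvalues of $A$ and of $B$, each repeated according to its algebraic multiplicity and numbered in any order, and let $$d_m(\mathrm{eig}(A),\mathrm{eig}(B)) := \min_{\sigma\in S_n}\ \max_{1\le j\le n}|\lambda_j(A)-\lambda_{\sigma(j)}(B)|$$ be the optimal matching distance, where $S_n$ is the set of all permutations of $\{1,\dots,n\}$ (its value does not depend on the numbering). Then $$d_m(\mathrm{eig}(A),\mathrm{eig}(B)) \le 4\,(\|A\|_2+\|B\|_2)^{1-1/n}\,\|A-B\|_2^{1/n},$$ where $\|\cdot\|_2$ is the spectral norm (the operator norm induced by the Euclidean norm on $\mathbb{C}^n$), and $0^0:=1$ (this matters only for $n=1$ and $A=B=0$). -/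

import Mathlib

open scoped Matrix.Norms.L2Operator

/-- The eigenvalues of a complex `n × n` matrix, counted with algebraic multiplicity, can be
numbered by `Fin n`. -/
theorem exists_eigenvalue_numbering {n : ℕ} (A : Matrix (Fin n) (Fin n) ℂ) :
    ∃ a : Fin n → ℂ, Finset.univ.val.map a = A.charpoly.roots := by
  have hcard : A.charpoly.roots.toList.length = n := by
    rw [Multiset.length_toList, ← (IsAlgClosed.splits A.charpoly).natDegree_eq_card_roots,
      Matrix.charpoly_natDegree_eq_dim, Fintype.card_fin]
  refine ⟨fun j => A.charpoly.roots.toList.get (j.cast hcard.symm), ?_⟩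
  rw [Fin.univ_val_map]
  conv_rhs => rw [← Multiset.coe_toList A.charpoly.roots]
  congr 1
  apply List.ext_get
  · simp [hcard]
  · intro i h1 h2
    simp

/-- A numbering `λ₁(A), …, λₙ(A)` of the `n` eigenvalues of `A`, each listed as often as its
algebraic multiplicity. -/
noncomputable def eigenvalueTuple {n : ℕ} (A : Matrix (Fin n) (Fin n) ℂ) : Fin n → ℂ :=
  (exists_eigenvalue_numbering A).choose

theorem eigenvalueTuple_spec {n : ℕ} (A : Matrix (Fin n) (Fin n) ℂ) :
    Finset.univ.val.map (eigenvalueTuple A) = A.charpoly.roots :=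
  (exists_eigenvalue_numbering A).choose_spec

/-- The optimal matching distance of two `n`-tuples of complex numbers: the minimum over all
permutations `σ` of the maximum over `j` of `|a j - b (σ j)|`. -/
noncomputable def matchingDist {n : ℕ} (a b : Fin n → ℂ) : ℝ :=
  ⨅ σ : Equiv.Perm (Fin n), ⨆ j : Fin n, ‖a j - b (σ j)‖

/-- The optimal matching distance `d_m(eig A, eig B)` of the spectra of `A` and `B`. -/
noncomputable def eigMatchingDist {n : ℕ} (A B : Matrix (Fin n) (Fin n) ℂ) : ℝ :=
  matchingDist (eigenvalueTuple A) (eigenvalueTuple B)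

theorem matchingDist_comp_perm {n : ℕ} (a b : Fin n → ℂ) (τ ρ : Equiv.Perm (Fin n)) :
    matchingDist (a ∘ τ) (b ∘ ρ) = matchingDist a b := by
  unfold matchingDist
  refine Equiv.iInf_congr ((Equiv.mulLeft ρ).trans (Equiv.mulRight τ⁻¹)) fun σ => ?_
  refine (Equiv.iSup_congr τ fun j => ?_).symm
  simp

/-- The distance of the spectra does not depend on how the eigenvalues are numbered. -/
theorem eigMatchingDist_eq {n : ℕ} (A B : Matrix (Fin n) (Fin n) ℂ) (a b : Fin n → ℂ)
    (ha : Finset.univ.val.map a = A.charpoly.roots)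
    (hb : Finset.univ.val.map b = B.charpoly.roots) :
    eigMatchingDist A B = matchingDist a b := by
  have key : ∀ f g : Fin n → ℂ,
      Finset.univ.val.map f = Finset.univ.val.map g → ∃ τ : Equiv.Perm (Fin n), f = g ∘ τ := by
    intro f g h
    have hc : ∀ c : ℂ, Nonempty ({i // f i = c} ≃ {i // g i = c}) := by
      intro c
      rw [← Fintype.card_eq, Fintype.card_subtype, Fintype.card_subtype]
      have h1 := congrArg (Multiset.count c) h
      simp only [Multiset.count_map, eq_comm (a := c)] at h1
      exact h1
    exact ⟨Equiv.ofFiberEquiv fun c => (hc c).some,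
      funext fun i => (Equiv.ofFiberEquiv_map _ i).symm⟩
  obtain ⟨τ, hτ⟩ := key _ a ((eigenvalueTuple_spec A).trans ha.symm)
  obtain ⟨ρ, hρ⟩ := key _ b ((eigenvalueTuple_spec B).trans hb.symm)
  rw [eigMatchingDist, hτ, hρ, matchingDist_comp_perm]

/-!
Let `‖A‖ ≤ ‖B‖`, let `p` be the characteristic polynomial of `A`, and put
`r = ‖A - B‖ (‖A‖ + ‖B‖) ^ (n - 1)`. Every eigenvalue `z` of a matrix `A + t (B - A)` with
`0 ≤ t ≤ 1` satisfies `|p z| ≤ r`: a determinant is at most the norm of the image of a unit vector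
times the `n - 1`st power of the operator norm
(`Matrix.norm_det_le_norm_mulVec_mul_norm_pow`), and this is applied to `z - A` at a unit
eigenvector (`Matrix.norm_eval_charpoly_le_of_mem_roots`). So all these eigenvalues lie in a
compact set `K` on which `|p| ≤ r`.

If eigenvalues `a` of `A` and `b` of `B` are more than `4 r ^ (1 / n)` apart, then Chebyshev's lower
bound for monic polynomials on an interval shows that a line orthogonal to the segment from `a` to
`b` separates them and misses `K` (`exists_continuous_separating_of_norm_prod_sub_le`). Eigenvalues
depending continuously on `t` cannot cross such a line, so each part into which these finitely many
lines cut `K` contains equally many eigenvalues of `A` and of `B`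
(`Matrix.map_charpoly_roots_eq_of_isLocallyConstant`). Matching the eigenvalues within the parts
never pairs two that are too far apart.

Continuous branches of eigenvalues are not needed: the invariance of the counts follows from the
compactness of `Kⁿ` and the connectedness of the unit interval.
-/

/-! ### Chebyshev's bound and separating lines -/

open Polynomial in
/-- Chebyshev's lower bound: a monic real polynomial of degree `n` attains on an interval of length
`L` an absolute value of at least `2 (L / 4) ^ n`. The factor `2` is given up in exchange for a
strict inequality. -/
theorem exists_mem_Icc_lt_abs_prod_sub {n : ℕ} (hn : 1 ≤ n) (s : Fin n → ℝ) {L : ℝ} (hL : 0 < L) :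
    ∃ x ∈ Set.Icc 0 L, (L / 4) ^ n < |∏ i, (x - s i)| := by
  by_contra! h
  set c : ℝ := (L / 4) ^ n with hc
  have hcpos : 0 < c := by positivity
  -- The substitution `x = L / 2 * (y + 1)` carries `[-1, 1]` to `[0, L]`.
  set P : ℝ[X] := C c⁻¹ * ∏ i, (C (L / 2) * X + C (L / 2 - s i)) with hP
  have hlin : ∀ i, (C (L / 2) * X + C (L / 2 - s i) : ℝ[X]).leadingCoeff = L / 2 := fun i =>
    leadingCoeff_linear (by positivity)
  have hdeg : P.degree ≤ n := by
    rw [hP, degree_C_mul (inv_ne_zero hcpos.ne'), degree_prod]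
    rw [Finset.sum_congr rfl fun i _ => degree_linear (show L / 2 ≠ 0 by positivity)]
    simp
  have hlead : P.leadingCoeff = c⁻¹ * (L / 2) ^ n := by
    simp only [hP, leadingCoeff_mul, leadingCoeff_prod, hlin, leadingCoeff_C, Finset.prod_const,
      Finset.card_univ, Fintype.card_fin]
  have hbnd : ∀ y ∈ Set.Icc (-1 : ℝ) 1, |P.eval y| ≤ 1 := by
    rintro y ⟨hy1, hy2⟩
    have hx := h (L / 2 * y + L / 2) ⟨by nlinarith, by nlinarith⟩
    rw [hP, eval_C_mul, eval_prod, abs_mul, abs_of_pos (inv_pos.2 hcpos), inv_mul_le_one₀ hcpos]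
    simpa [add_sub_assoc] using hx
  have h2 := Chebyshev.leadingCoeff_le_of_forall_abs_le_one hdeg hbnd
  rw [hlead, show L / 2 = L / 4 * 2 by ring, mul_pow, ← hc, inv_mul_cancel_left₀ hcpos.ne'] at h2
  exact absurd h2 (not_le.2 (pow_lt_pow_right₀ one_lt_two (by omega)))

/-- If `p = ∏ (z - ρ i)` is bounded by `r < (‖b - a‖ / 4) ^ n` on a set `K` containing `a` and `b`,
then some line orthogonal to the segment from `a` to `b` misses `K` and separates `a` from `b`.
Indeed, orthogonal projection onto the line through `a` and `b` does not increase distances, so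
`|p|` dominates the polynomial with the projected roots at the projected point, and Chebyshev's
bound yields a point of the segment where the latter exceeds `r`. -/
theorem exists_continuous_separating_of_norm_prod_sub_le {n : ℕ} (hn : 1 ≤ n) (ρ : Fin n → ℂ)
    {K : Set ℂ} {r : ℝ} (hK : ∀ z ∈ K, ‖∏ i, (z - ρ i)‖ ≤ r) {a b : ℂ} (ha : a ∈ K) (hb : b ∈ K)
    (hab : r < (‖b - a‖ / 4) ^ n) :
    ∃ f : ℂ → ℝ, Continuous f ∧ f a < 0 ∧ 0 < f b ∧ ∀ z ∈ K, f z ≠ 0 := by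
  set L := ‖b - a‖ with hLdef
  have hL : 0 < L := by
    refine (norm_nonneg _).lt_of_ne' fun h0 => ?_
    rw [← hLdef] at h0
    rw [h0, zero_div, zero_pow (by omega)] at hab
    exact absurd ((norm_nonneg _).trans (hK a ha)) (not_le.2 hab)
  -- The coordinate of the orthogonal projection of `z` onto the line from `a` to `b`.
  set g : ℂ → ℝ := fun z => ((starRingEnd ℂ) (b - a) * (z - a)).re / L with hg
  have hgle : ∀ z w, |g z - g w| ≤ ‖z - w‖ := by
    intro z w
    have : g z - g w = ((starRingEnd ℂ) (b - a) * (z - w)).re / L := by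
      simp only [hg, ← sub_div, ← Complex.sub_re]
      ring_nf
    rw [this, abs_div, abs_of_pos hL, div_le_iff₀ hL]
    refine (Complex.abs_re_le_norm _).trans ?_
    rw [norm_mul, Complex.norm_conj, mul_comm]
  have hga : g a = 0 := by simp [hg]
  have hgb : g b = L := by
    simp only [hg]
    rw [Complex.conj_mul', ← Complex.ofReal_pow, Complex.ofReal_re, ← hLdef]
    field_simp
  obtain ⟨x, ⟨hx0, hxL⟩, hx⟩ := exists_mem_Icc_lt_abs_prod_sub hn (fun i => g (ρ i)) hL
  have hne : ∀ z ∈ K, g z ≠ x := by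
    rintro z hz rfl
    have : |∏ i, (g z - g (ρ i))| ≤ ‖∏ i, (z - ρ i)‖ := by
      rw [Finset.abs_prod, norm_prod]
      exact Finset.prod_le_prod (fun _ _ => abs_nonneg _) fun i _ => hgle _ _
    linarith [hK z hz]
  refine ⟨fun z => g z - x, by fun_prop, ?_, ?_, fun z hz => sub_ne_zero.2 (hne z hz)⟩
  · have := hne a ha
    rw [hga] at this
    simpa [hga] using hx0.lt_of_ne this
  · have := hne b hb
    rw [hgb] at this
    simpa [hgb] using hxL.lt_of_ne' this

theorem isLocallyConstant_pos_iff {K : Set ℂ} {ι : Type*} [Finite ι] {f : ι → ℂ → ℝ}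
    (hf : ∀ i, Continuous (f i)) (hK : ∀ i, ∀ z ∈ K, f i z ≠ 0) :
    IsLocallyConstant (K.domRestrict fun z i => 0 < f i z) := by
  rw [IsLocallyConstant.iff_eventually_eq]
  intro z
  have hev : ∀ᶠ w : K in nhds z, ∀ i, (0 < f i w ↔ 0 < f i z) := by
    rw [Filter.eventually_all]
    intro i
    have hcont : Continuous fun w : K => f i w := (hf i).comp continuous_subtype_val
    rcases (hK i z z.2).lt_or_gt with h | h
    · filter_upwards [hcont.continuousAt.eventually_lt continuousAt_const h] with w hw
      exact iff_of_false hw.not_gt h.not_gt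
    · filter_upwards [continuousAt_const.eventually_lt hcont.continuousAt h] with w hw
      exact iff_of_true hw h
  filter_upwards [hev] with w hw
  exact funext fun i => propext (hw i)

/-! ### Determinants and eigenvalues of nearby matrices -/

open Matrix in
/-- The determinant is in absolute value the product of the singular values. All of them are at most
`‖M‖`, and the smallest one is at most `‖M v‖` for every unit vector `v`. -/
theorem Matrix.norm_det_le_norm_mulVec_mul_norm_pow {n : ℕ} (M : Matrix (Fin n) (Fin n) ℂ)
    (v : EuclideanSpace ℂ (Fin n)) (hv : ‖v‖ = 1) :
    ‖M.det‖ ≤ ‖toEuclideanCLM (n := Fin n) (𝕜 := ℂ) M v‖ * ‖M‖ ^ (n - 1) := by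
  set T := toEuclideanCLM (n := Fin n) (𝕜 := ℂ) M with hT
  have hH : (Mᴴ * M).IsHermitian := isHermitian_conjTranspose_mul_self M
  set μ := hH.eigenvalues with hμ
  set u := hH.eigenvectorBasis with hu
  have hTT : ∀ x i, inner ℂ (T (u i)) (T x) = (μ i : ℂ) * inner ℂ (u i) x := by
    intro x i
    have h1 : T.adjoint (T (u i)) = (μ i : ℂ) • u i := by
      have : T.adjoint = toEuclideanCLM (n := Fin n) (𝕜 := ℂ) Mᴴ := by
        rw [hT, ← star_eq_conjTranspose, map_star]; rfl
      rw [this, ← mul_apply_eq_comp, hT, ← map_mul]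
      ext k
      have := congrFun (hH.mulVec_eigenvectorBasis i) k
      simpa using this
    rw [← ContinuousLinearMap.adjoint_inner_left, h1, inner_smul_left, Complex.conj_ofReal]
  -- The singular values of `M` are the norms `‖T (u i)‖`.
  have hμsq : ∀ i, μ i = ‖T (u i)‖ ^ 2 := by
    intro i
    have := hTT (u i) i
    rw [inner_self_eq_norm_sq_to_K, inner_self_eq_norm_sq_to_K, u.norm_eq_one] at this
    simp only [Complex.coe_algebraMap, Complex.ofReal_one, one_pow, mul_one] at this
    exact_mod_cast this.symm
  have hTv : ‖T v‖ ^ 2 = ∑ i, μ i * ‖inner ℂ (u i) v‖ ^ 2 := by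
    have h1 : inner ℂ (T v) (T v) = ∑ i, (μ i : ℂ) * (‖inner ℂ (u i) v‖ : ℂ) ^ 2 := by
      rw [← ContinuousLinearMap.adjoint_inner_left, ← u.sum_inner_mul_inner]
      refine Finset.sum_congr rfl fun i _ => ?_
      rw [ContinuousLinearMap.adjoint_inner_left, ← inner_conj_symm, hTT, map_mul,
        Complex.conj_ofReal, mul_assoc, Complex.conj_mul']
    rw [inner_self_eq_norm_sq_to_K] at h1
    simp only [Complex.coe_algebraMap] at h1
    exact_mod_cast h1
  -- `‖T v‖ ^ 2` is a weighted mean of the `μ i`, so it is not below all of them.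
  have hmin : ∃ i, μ i ≤ ‖T v‖ ^ 2 := by
    by_contra! h
    have hsum := u.sum_sq_norm_inner_right v
    rw [hv] at hsum
    have : ∑ i, (μ i - ‖T v‖ ^ 2) * ‖inner ℂ (u i) v‖ ^ 2 = 0 := by
      simp only [sub_mul, Finset.sum_sub_distrib, ← Finset.mul_sum, hsum, ← hTv]; ring
    rw [Finset.sum_eq_zero_iff_of_nonneg
      fun i _ => mul_nonneg (sub_nonneg.2 (h i).le) (sq_nonneg _)] at this
    have h0 : ∀ i, ‖inner ℂ (u i) v‖ ^ 2 = 0 := fun i =>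
      (mul_eq_zero.1 (this i (Finset.mem_univ i))).resolve_left (sub_pos.2 (h i)).ne'
    simp [h0] at hsum
  obtain ⟨i, hi⟩ := hmin
  have hdet : ‖M.det‖ = ∏ i, ‖T (u i)‖ := by
    have h1 : (‖M.det‖ ^ 2 : ℝ) = (∏ i, ‖T (u i)‖) ^ 2 := by
      have h2 := hH.det_eq_prod_eigenvalues
      rw [det_mul, det_conjTranspose] at h2
      have h3 := congrArg norm h2
      rw [norm_mul, norm_star, norm_prod] at h3
      rw [sq, h3, ← Finset.prod_pow]
      refine Finset.prod_congr rfl fun i _ => ?_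
      rw [← hμsq]
      have hi : 0 ≤ μ i := hμsq i ▸ sq_nonneg _
      exact (RCLike.norm_ofReal _).trans (abs_of_nonneg hi)
    exact (pow_left_inj₀ (norm_nonneg _) (Finset.prod_nonneg fun _ _ => norm_nonneg _)
      two_ne_zero).1 h1
  rw [hdet, ← Finset.mul_prod_erase _ _ (Finset.mem_univ i)]
  have hcard : (Finset.univ.erase i).card = n - 1 := by simp
  refine mul_le_mul ?_ ?_ (Finset.prod_nonneg fun _ _ => norm_nonneg _) (norm_nonneg _)
  · rw [hμsq] at hi
    exact (pow_le_pow_iff_left₀ (norm_nonneg _) (norm_nonneg _) two_ne_zero).1 hi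
  · rw [← hcard]
    rw [← Finset.prod_const]
    refine Finset.prod_le_prod (fun _ _ => norm_nonneg _) fun k _ => ?_
    have := T.le_opNorm (u k)
    rwa [u.norm_eq_one, mul_one] at this

open Matrix in
/-- An eigenvalue `z` of `C` nearly annihilates the characteristic polynomial of a matrix `A` close
to `C`: a unit eigenvector `v` of `C` satisfies `(z - A) v = (C - A) v`, so that the determinant
bound for `z - A` at `v` gains the factor `‖A - C‖`. -/
theorem Matrix.norm_eval_charpoly_le_of_mem_roots {n : ℕ} (A C : Matrix (Fin n) (Fin n) ℂ) {z : ℂ}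
    (hz : z ∈ C.charpoly.roots) :
    ‖z‖ ≤ ‖C‖ ∧ ‖A.charpoly.eval z‖ ≤ ‖A - C‖ * (‖A‖ + ‖C‖) ^ (n - 1) := by
  have hdet : (Matrix.scalar (Fin n) z - C).det = 0 := by
    rw [← Matrix.eval_charpoly]
    exact Polynomial.isRoot_of_mem_roots hz
  obtain ⟨w, hw0, hw⟩ := Matrix.exists_mulVec_eq_zero_iff.2 hdet
  have hw' : WithLp.toLp 2 w ≠ 0 := by simpa using hw0
  set v : EuclideanSpace ℂ (Fin n) := ((‖WithLp.toLp 2 w‖⁻¹ : ℝ) : ℂ) • WithLp.toLp 2 w with hv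
  have hv1 : ‖v‖ = 1 := by
    rw [hv, norm_smul, Complex.norm_real, norm_inv, norm_norm,
      inv_mul_cancel₀ (norm_ne_zero_iff.2 hw')]
  let Φ := toEuclideanCLM (n := Fin n) (𝕜 := ℂ)
  have hscalar : Φ (Matrix.scalar (Fin n) z) = z • 1 := by
    rw [← map_one Φ, ← map_smul, Matrix.smul_one_eq_diagonal]
    rfl
  have hCv : Φ C v = z • v := by
    have : Φ (Matrix.scalar (Fin n) z - C) v = 0 := by
      rw [hv, map_smul, toEuclideanCLM_toLp, hw]; simp
    rw [map_sub, hscalar] at this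
    simpa using (sub_eq_zero.1 this).symm
  have hle : ∀ M, ‖Φ M v‖ ≤ ‖M‖ := fun M => by
    have := (Φ M).le_opNorm v
    rwa [hv1, mul_one] at this
  have hzC : ‖z‖ ≤ ‖C‖ := by
    have := hle C
    rwa [hCv, norm_smul, hv1, mul_one] at this
  have hMv : ‖Φ (Matrix.scalar (Fin n) z - A) v‖ ≤ ‖A - C‖ := by
    have : Φ (Matrix.scalar (Fin n) z - A) v = Φ (C - A) v := by
      rw [map_sub, map_sub, hscalar, _root_.sub_apply, _root_.sub_apply, hCv]
      simp
    rw [this, norm_sub_rev]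
    exact hle _
  have hM : ‖Matrix.scalar (Fin n) z - A‖ ≤ ‖A‖ + ‖C‖ := by
    have hs : ‖Matrix.scalar (Fin n) z‖ ≤ ‖z‖ := by
      rw [Matrix.scalar_apply, Matrix.l2_opNorm_diagonal]
      exact pi_norm_const_le z
    linarith [norm_sub_le (Matrix.scalar (Fin n) z) A]
  refine ⟨hzC, ?_⟩
  rw [Matrix.eval_charpoly]
  refine (Matrix.norm_det_le_norm_mulVec_mul_norm_pow _ v hv1).trans ?_
  gcongr

/-! ### Eigenvalues along a connected family of matrices -/

theorem Matrix.map_univ_eq_charpoly_roots_iff {n : ℕ} (A : Matrix (Fin n) (Fin n) ℂ)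
    (a : Fin n → ℂ) :
    Finset.univ.val.map a = A.charpoly.roots ↔
      ∀ z, A.charpoly.eval z = ∏ j, (z - a j) := by
  constructor
  · intro h z
    rw [(IsAlgClosed.splits A.charpoly).eq_prod_roots_of_monic A.charpoly_monic, ← h,
      Multiset.map_map, Polynomial.eval_multiset_prod, Multiset.map_map]
    simp [Finset.prod]
  · intro h
    have : A.charpoly =
        ((Finset.univ.val.map a).map fun r => Polynomial.X - Polynomial.C r).prod := by
      refine Polynomial.funext fun z => ?_
      rw [h, Multiset.map_map, Polynomial.eval_multiset_prod, Multiset.map_map]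
      simp [Finset.prod]
    rw [this, Polynomial.roots_multiset_prod_X_sub_C]

/-- Along a continuous family of matrices with all eigenvalues in a compact set `K`, the number of
eigenvalues in each class of a locally constant partition of `K` does not change. The set `E` of
pairs of a parameter and a numbering of the eigenvalues is closed in `X × Kⁿ`, so its projection to
`X` is a closed surjection, hence a quotient map. The multiset of classes is locally constant on
`E` and depends on the parameter alone, so it is locally constant on `X`. -/
theorem Matrix.map_charpoly_roots_eq_of_isLocallyConstant {n : ℕ} {X T : Type*}
    [TopologicalSpace X] [PreconnectedSpace X] {A : X → Matrix (Fin n) (Fin n) ℂ}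
    (hA : Continuous A) {K : Set ℂ} (hK : IsCompact K)
    (hroots : ∀ x, ∀ z ∈ (A x).charpoly.roots, z ∈ K) {c : ℂ → T}
    (hc : IsLocallyConstant (K.domRestrict c)) (x y : X) :
    (A x).charpoly.roots.map c = (A y).charpoly.roots.map c := by
  have : CompactSpace K := isCompact_iff_compactSpace.1 hK
  set E : Set (X × (Fin n → K)) :=
    {q | ∀ z, (A q.1).charpoly.eval z = ∏ j, (z - q.2 j)} with hE
  have hEclosed : IsClosed E := by
    simp only [hE, Set.ofPred_forall, Matrix.eval_charpoly]
    refine isClosed_iInter fun z => isClosed_eq ?_ ?_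
    · exact (continuous_const.sub (hA.comp continuous_fst)).matrix_det
    · fun_prop
  set π : E → X := fun q => q.1.1
  have hπ : Topology.IsQuotientMap π := by
    refine IsClosedMap.isQuotientMap
      (isClosedMap_fst_of_compactSpace.comp hEclosed.isClosedEmbedding_subtypeVal.isClosedMap)
      (continuous_fst.comp continuous_subtype_val) fun x => ?_
    obtain ⟨a, ha⟩ := exists_eigenvalue_numbering (A x)
    have haK : ∀ j, a j ∈ K := fun j => hroots x _ (ha ▸ Multiset.mem_map_of_mem a (by simp))
    exact ⟨⟨(x, fun j => ⟨a j, haK j⟩), (map_univ_eq_charpoly_roots_iff _ _).1 ha⟩, rfl⟩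
  have hg : IsLocallyConstant fun q : E => (A (π q)).charpoly.roots.map c := by
    rw [IsLocallyConstant.iff_eventually_eq]
    intro q
    have hev : ∀ᶠ q' : E in nhds q, ∀ j, c (q'.1.2 j) = c (q.1.2 j) := by
      rw [Filter.eventually_all]
      intro j
      have hcont : Continuous fun q' : E => q'.1.2 j := by fun_prop
      exact hcont.continuousAt.eventually ((IsLocallyConstant.iff_eventually_eq _).1 hc (q.1.2 j))
    filter_upwards [hev] with q' hq'
    rw [← (map_univ_eq_charpoly_roots_iff _ _).2 q.2,
      ← (map_univ_eq_charpoly_roots_iff _ _).2 q'.2, Multiset.map_map, Multiset.map_map]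
    exact Multiset.map_congr rfl fun j _ => hq' j
  have hh : IsLocallyConstant fun x => (A x).charpoly.roots.map c := fun s =>
    hπ.isOpen_preimage.1 (hg s)
  exact hh.apply_eq_of_preconnectedSpace x y

/-! ### Matching the eigenvalues -/

theorem exists_perm_of_map_univ_eq {ι T : Type*} [Fintype ι] {f g : ι → T}
    (h : Finset.univ.val.map f = Finset.univ.val.map g) :
    ∃ σ : Equiv.Perm ι, ∀ i, f i = g (σ i) := by
  classical
  have hc : ∀ c, Nonempty ({i // f i = c} ≃ {i // g i = c}) := by
    intro c
    rw [← Fintype.card_eq, Fintype.card_subtype, Fintype.card_subtype]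
    have h1 := congrArg (Multiset.count c) h
    simp only [Multiset.count_map, eq_comm (a := c)] at h1
    exact h1
  exact ⟨Equiv.ofFiberEquiv fun c => (hc c).some, fun i => (Equiv.ofFiberEquiv_map _ i).symm⟩

/-- Eigenvalues on the segment from `A` to `B` stay where the characteristic polynomial of `A` is
small, provided that `‖A‖ ≤ ‖B‖`. -/
theorem Matrix.norm_le_and_norm_eval_charpoly_le_of_segment {n : ℕ}
    {A B : Matrix (Fin n) (Fin n) ℂ} (hAB : ‖A‖ ≤ ‖B‖) {t : ℝ} (ht0 : 0 ≤ t) (ht1 : t ≤ 1) {z : ℂ}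
    (hz : z ∈ (A + (t : ℂ) • (B - A)).charpoly.roots) :
    ‖z‖ ≤ ‖B‖ ∧ ‖A.charpoly.eval z‖ ≤ ‖A - B‖ * (‖A‖ + ‖B‖) ^ (n - 1) := by
  obtain ⟨h1, h2⟩ := Matrix.norm_eval_charpoly_le_of_mem_roots A _ hz
  have hnorm : ‖A + (t : ℂ) • (B - A)‖ ≤ ‖B‖ := by
    have : A + (t : ℂ) • (B - A) = ((1 - t : ℝ) : ℂ) • A + (t : ℂ) • B := by
      rw [Complex.ofReal_sub, Complex.ofReal_one, sub_smul, one_smul, smul_sub]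
      abel
    rw [this]
    refine (norm_add_le _ _).trans ?_
    rw [norm_smul, norm_smul, Complex.norm_of_nonneg ht0,
      Complex.norm_of_nonneg (sub_nonneg.2 ht1)]
    calc (1 - t) * ‖A‖ + t * ‖B‖ ≤ (1 - t) * ‖B‖ + t * ‖B‖ := by
          have := mul_le_mul_of_nonneg_left hAB (sub_nonneg.2 ht1)
          linarith
      _ = ‖B‖ := by ring
  have hsub : ‖A - (A + (t : ℂ) • (B - A))‖ ≤ ‖A - B‖ := by
    have : A - (A + (t : ℂ) • (B - A)) = (t : ℂ) • (A - B) := by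
      rw [sub_add_cancel_left, ← smul_neg, neg_sub]
    rw [this, norm_smul, Complex.norm_of_nonneg ht0]
    exact mul_le_of_le_one_left (norm_nonneg _) ht1
  have hpow : (‖A‖ + ‖A + (t : ℂ) • (B - A)‖) ^ (n - 1) ≤ (‖A‖ + ‖B‖) ^ (n - 1) :=
    pow_le_pow_left₀ (by positivity) (by linarith) _
  exact ⟨h1.trans hnorm, h2.trans (mul_le_mul hsub hpow (by positivity) (norm_nonneg _))⟩

/-- Every pair of eigenvalues farther apart than `β` is separated by a line that no eigenvalue of
the segment from `A` to `B` meets. A permutation that preserves the sides of all these lines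
therefore matches no such pair. -/
theorem Matrix.exists_perm_norm_sub_le_of_norm_le {n : ℕ} (hn : 1 ≤ n)
    {A B : Matrix (Fin n) (Fin n) ℂ} (hAB : ‖A‖ ≤ ‖B‖) {a b : Fin n → ℂ}
    (ha : Finset.univ.val.map a = A.charpoly.roots)
    (hb : Finset.univ.val.map b = B.charpoly.roots) {β : ℝ} (hβ : 0 ≤ β)
    (hr : ‖A - B‖ * (‖A‖ + ‖B‖) ^ (n - 1) ≤ (β / 4) ^ n) :
    ∃ σ : Equiv.Perm (Fin n), ∀ j, ‖a j - b (σ j)‖ ≤ β := by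
  obtain ⟨K, hK, hKle, γ, hγ, hγ0, hγ1, hroots⟩ : ∃ K : Set ℂ, IsCompact K ∧
      (∀ z ∈ K, ‖A.charpoly.eval z‖ ≤ ‖A - B‖ * (‖A‖ + ‖B‖) ^ (n - 1)) ∧
      ∃ γ : unitInterval → Matrix (Fin n) (Fin n) ℂ, Continuous γ ∧ γ 0 = A ∧ γ 1 = B ∧
        ∀ t, ∀ z ∈ (γ t).charpoly.roots, z ∈ K := by
    refine ⟨Metric.closedBall 0 ‖B‖ ∩
      {z | ‖A.charpoly.eval z‖ ≤ ‖A - B‖ * (‖A‖ + ‖B‖) ^ (n - 1)}, ?_, fun z hz => hz.2,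
      fun t => A + ((t : ℝ) : ℂ) • (B - A), by fun_prop, by simp, by simp, fun t z hz => ?_⟩
    · exact (isCompact_closedBall _ _).inter_right (isClosed_le (by fun_prop) continuous_const)
    · obtain ⟨h1, h2⟩ :=
        Matrix.norm_le_and_norm_eval_charpoly_le_of_segment hAB t.2.1 t.2.2 hz
      exact ⟨mem_closedBall_zero_iff.2 h1, h2⟩
  have haK : ∀ j, a j ∈ K := fun j => by
    refine hroots 0 (a j) ?_
    rw [hγ0, ← ha]
    exact Multiset.mem_map_of_mem a (Finset.mem_univ_val j)
  have hbK : ∀ j, b j ∈ K := fun j => by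
    refine hroots 1 (b j) ?_
    rw [hγ1, ← hb]
    exact Multiset.mem_map_of_mem b (Finset.mem_univ_val j)
  have hprod : ∀ z ∈ K, ‖∏ i, (z - a i)‖ ≤ ‖A - B‖ * (‖A‖ + ‖B‖) ^ (n - 1) := fun z hz => by
    rw [← (Matrix.map_univ_eq_charpoly_roots_iff A a).1 ha]
    exact hKle z hz
  -- One separating line for each pair of eigenvalues that are too far apart to be matched.
  have hsep : ∀ p : {p : Fin n × Fin n // β < ‖b p.2 - a p.1‖}, ∃ f : ℂ → ℝ,
      Continuous f ∧ f (a p.1.1) < 0 ∧ 0 < f (b p.1.2) ∧ ∀ z ∈ K, f z ≠ 0 := by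
    rintro ⟨⟨j, k⟩, hjk⟩
    have hlt : (β / 4) ^ n < (‖b k - a j‖ / 4) ^ n :=
      pow_lt_pow_left₀ (div_lt_div_of_pos_right hjk four_pos) (by positivity) (by omega)
    exact exists_continuous_separating_of_norm_prod_sub_le hn a hprod (haK j) (hbK k)
      (hr.trans_lt hlt)
  choose f hfc hfa hfb hfK using hsep
  -- Points of `K` are classified by the sides of the separating lines on which they lie.
  have hmap := Matrix.map_charpoly_roots_eq_of_isLocallyConstant hγ hK hroots
    (isLocallyConstant_pos_iff hfc hfK) 0 1
  rw [hγ0, hγ1, ← ha, ← hb, Multiset.map_map, Multiset.map_map] at hmap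
  obtain ⟨σ, hσ⟩ := exists_perm_of_map_univ_eq hmap
  refine ⟨σ, fun j => ?_⟩
  by_contra! hj
  rw [norm_sub_rev] at hj
  have h : (0 < f ⟨(j, σ j), hj⟩ (a j)) = (0 < f ⟨(j, σ j), hj⟩ (b (σ j))) :=
    congrFun (hσ j) ⟨(j, σ j), hj⟩
  exact (hfa ⟨(j, σ j), hj⟩).not_gt (h.mpr (hfb ⟨(j, σ j), hj⟩))

theorem matchingDist_le_of_perm {n : ℕ} {a b : Fin n → ℂ} {β : ℝ} (hβ : 0 ≤ β)
    (σ : Equiv.Perm (Fin n)) (h : ∀ j, ‖a j - b (σ j)‖ ≤ β) : matchingDist a b ≤ β :=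
  (ciInf_le (Set.finite_range _).bddBelow σ).trans (Real.iSup_le h hβ)

theorem mainTheorem8 (n : ℕ) (hn : 1 ≤ n) (A B : Matrix (Fin n) (Fin n) ℂ) :
    eigMatchingDist A B ≤
      4 * (‖A‖ + ‖B‖) ^ (1 - 1 / (n : ℝ)) * ‖A - B‖ ^ (1 / (n : ℝ)) := by
  have hn0 : (n : ℝ) ≠ 0 := by positivity
  set β := 4 * (‖A‖ + ‖B‖) ^ (1 - 1 / (n : ℝ)) * ‖A - B‖ ^ (1 / (n : ℝ)) with hβdef
  have hβ : 0 ≤ β := by positivity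
  have hpow : (β / 4) ^ n = ‖A - B‖ * (‖A‖ + ‖B‖) ^ (n - 1) := by
    have h1 : ((‖A‖ + ‖B‖) ^ (1 - 1 / (n : ℝ))) ^ n = (‖A‖ + ‖B‖) ^ (n - 1) := by
      rw [← Real.rpow_mul_natCast (by positivity), ← Real.rpow_natCast, Nat.cast_sub hn]
      congr 1
      field_simp
      simp
    have h2 : (‖A - B‖ ^ (1 / (n : ℝ))) ^ n = ‖A - B‖ := by
      rw [one_div, Real.rpow_inv_natCast_pow (norm_nonneg _) (by omega)]
    rw [hβdef, mul_assoc, mul_div_cancel_left₀ _ four_ne_zero, mul_pow, h1, h2, mul_comm]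
  have ha := eigenvalueTuple_spec A
  have hb := eigenvalueTuple_spec B
  -- The matching lemma needs `‖A‖ ≤ ‖B‖`; otherwise it is applied to `B` and `A`.
  rcases le_total ‖A‖ ‖B‖ with h | h
  · obtain ⟨σ, hσ⟩ := Matrix.exists_perm_norm_sub_le_of_norm_le hn h ha hb hβ hpow.ge
    exact matchingDist_le_of_perm hβ σ hσ
  · rw [norm_sub_rev, add_comm ‖A‖] at hpow
    obtain ⟨σ, hσ⟩ := Matrix.exists_perm_norm_sub_le_of_norm_le hn h hb ha hβ hpow.ge
    refine matchingDist_le_of_perm hβ σ⁻¹ fun j => ?_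
    have := hσ (σ⁻¹ j)
    rwa [norm_sub_rev, ← Equiv.Perm.mul_apply, mul_inv_cancel, Equiv.Perm.one_apply] at this
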